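/- **Setting.** A *layered circuit* of depth $L$ on $n$ qubits is $$U(\boldsymbol\theta)=\prod_{\ell=1}^{L}\Big(V_\ell\prod_{j=1}^{m_\ell}e^{-i\theta_{\ell,j}G_{\ell,j}}\Big)$$ with fixed unitaries $V_\ell$ on $(\mathbb C^2)^{\otimes n}$, Hermitian generators $G_{\ell,j}$ and independent parameters $\boldsymbol\theta\in\mathbb R^M$, $M=\sum_\ell m_\ell$; $|\psi(\boldsymbol\theta)\rangle=U(\boldsymbol\theta)|0\rangle^{\otimes n}$. The support $\mathrm{supp}(A)$ of an operator $A$ is the set of qubits on which $A$ acts non-trivially. Let $\rho$ be the law under which the parameters are i.i.d. uniform on $[0,2\pi)$, and for a cost $C(\boldsymbol\theta)$ let $H_{ab}=\partial^2C/\partial\theta_a\partial\theta_b$. Consider a family of such circuits with $n\to\infty$ such that, for a fixed $r\in\mathbb N$, every generator satisfies $|\mathrm{supp}(G_{\ell,j})|\le r$ and $G_{\ell,j}^2=\frac14 I$ (spectrum $\{\pm\frac12\}$), and $rL=o(n)$, where $L=L(n)$ is the depth. **Theorem.** For every circuit of the family and all parameter indices $a,b$ the following hold. (i) *Global objectives.*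 Let $C(\boldsymbol\theta)=\langle\psi(\boldsymbol\theta)|O|\psi(\boldsymbol\theta)\rangle$ with $O=O_n$ Hermitian, $\|O\|\le1$, and $|\mathrm{supp}(O)|$ growing linearly with $n$. If $\mathrm{Var}_\rho[C]\le c_{\rm g}(r,L)\,e^{-\alpha(r,L)n}$ with $c_{\rm g},\alpha>0$ not depending on $n$ otherwise than through $L$, then $$\mathrm{Var}_\rho(H_{ab})\le\tilde c(r,L)\,e^{-\tilde\alpha(r,L)n},$$ where the positive functions $\tilde c,\tilde\alpha$ of $(r,L)$ depend only on the functions $c_{\rm g},\alpha$. (ii) *Local objectives.* Let $G=G_n$ be a graph on the $n$ qubits that is an interaction graph of the circuit, meaning: (a) for every $\ell$ and every qubit $q$, an operator $A$ acting only on $q$ is mapped to an operator $V_\ell^\dagger AV_\ell$ acting only on $q$ and its neighbours in $G$; (b) in each layer every generator acts inside an assigned block of qubits whose pairwise distances in $G$ are less than $r$ (for example a connected set of at most $r$ qubits), and generators of the same layer that are assigned different blocks commute. Let $$C(\boldsymbol\theta)=\frac1n\sum_{v=1}^n\langle\psi(\boldsymbol\theta)|O_v|\psi(\boldsymbol\theta)\rangle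 ,$$ where each $O_v$ is Hermitian with $\|O_v\|\le1$ and acts on at most $k$ qubits, all within distance $k$ of the qubit $v$ in $G$. With $V_G(m)=\max_v|B_G(v,m)|$, the maximal number of vertices in a ball of radius $m$, there is a positive function $c_{\rm loc}$ of $(k,r,L)$ alone, not depending on the family, such that $$\mathrm{Var}_\rho(H_{ab})\le c_{\rm loc}(k,r,L)\,\frac{V_G(k+2rL)}{n}.$$ In particular, if $V_G(m)\le K m^D$ for all $m\ge1$ and all graphs of the family, with fixed $K>0$ and $D\in\mathbb R$, then $$\mathrm{Var}_\rho(H_{ab})\le c_{\rm loc}'(k,r,L)\,\frac{(k+2rL)^D}{n},$$ where the positive function $c_{\rm loc}'$ depends only on $D$ and $K$. -/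

import Mathlib

open MeasureTheory Filter
open scoped Matrix

noncomputable section

namespace PQC

/-! ### Qubits, operators and supports -/

/-- Labels of the computational basis of the `n`-qubit space `(ℂ²)^{⊗n}`. -/
abbrev Bits (n : ℕ) : Type := Fin n → Fin 2

/-- Operators on the `n`-qubit space, as matrices in the computational basis. -/
abbrev Op (n : ℕ) : Type := Matrix (Bits n) (Bits n) ℂ

/-- `A` acts as the identity on qubit `q`: `A = I_q ⊗ A'`, written out on matrix entries. -/
def ActsTriviallyAt {n : ℕ} (A : Op n) (q : Fin n) : Prop :=
  (∀ x y : Bits n, x q ≠ y q → A x y = 0) ∧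
  (∀ (x y : Bits n) (b : Fin 2), x q = y q →
    A (Function.update x q b) (Function.update y q b) = A x y)

open Classical in
/-- The support of an operator: the qubits on which it acts non-trivially. -/
def supp {n : ℕ} (A : Op n) : Finset (Fin n) :=
  Finset.univ.filter fun q => ¬ ActsTriviallyAt A q

/-- The operator norm on the `n`-qubit Hilbert space. -/
def opNorm {n : ℕ} (A : Op n) : ℝ := ‖Matrix.toEuclideanCLM (𝕜 := ℂ) A‖

/-- A normalized observable: Hermitian of operator norm at most one. -/
structure IsNormalizedObservable {n : ℕ} (O : Op n) : Prop where
  hermitian : O.IsHermitian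
  norm_le : opNorm O ≤ 1

/-! ### Layered parameterized circuits -/

/-- A layered circuit on `n` qubits: layer `ℓ` consists of a fixed entangling unitary `ent ℓ` and
of `gates ℓ` rotations with generators `gen ℓ j`, each with its own parameter. -/
structure Circuit (n : ℕ) where
  depth : ℕ
  gates : Fin depth → ℕ
  ent : Fin depth → Matrix.unitaryGroup (Bits n) ℂ
  gen : (ℓ : Fin depth) → Fin (gates ℓ) → Op n

namespace Circuit

variable {n : ℕ} (c : Circuit n)

/-- The index set of the parameters. -/
abbrev Idx : Type := (ℓ : Fin c.depth) × Fin (c.gates ℓ)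

/-- Layer `ℓ`: the operator `V_ℓ ∏_j exp(-i θ_{ℓ,j} G_{ℓ,j})`. -/
def layer (θ : c.Idx → ℝ) (ℓ : Fin c.depth) : Op n :=
  (c.ent ℓ : Op n) *
    (List.ofFn fun j : Fin (c.gates ℓ) =>
      NormedSpace.exp ((-Complex.I * (θ ⟨ℓ, j⟩ : ℂ)) • c.gen ℓ j)).prod

/-- The circuit unitary `U(θ) = ∏_ℓ V_ℓ ∏_j exp(-i θ_{ℓ,j} G_{ℓ,j})`. -/
def unitary (θ : c.Idx → ℝ) : Op n := (List.ofFn (c.layer θ)).prod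

/-- The state `|ψ(θ)⟩ = U(θ)|0…0⟩`. -/
def state (θ : c.Idx → ℝ) : Bits n → ℂ := c.unitary θ *ᵥ Pi.single 0 1

/-- The cost `C(θ) = ⟨ψ(θ)| O |ψ(θ)⟩` (real, as `O` is Hermitian). -/
def cost (O : Op n) (θ : c.Idx → ℝ) : ℝ :=
  (star (c.state θ) ⬝ᵥ (O *ᵥ c.state θ)).re

/-- The averaged cost `(1/n) ∑_v ⟨ψ(θ)| O_v |ψ(θ)⟩`. -/
def averagedCost (O : Fin n → Op n) (θ : c.Idx → ℝ) : ℝ :=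
  (1 / (n : ℝ)) * ∑ v, c.cost (O v) θ

/-- Initialization: the parameters are i.i.d. uniform on `[0, 2π)`. -/
def initLaw : Measure (c.Idx → ℝ) :=
  Measure.pi fun _ => ProbabilityTheory.cond volume (Set.Ico 0 (2 * Real.pi))

/-- Two-point-spectrum generators: each generator is Hermitian, is supported on at most `r` qubits
and has eigenvalues `±1/2`, i.e. squares to `I/4`. -/
def HasTwoPointGenerators (r : ℕ) : Prop :=
  ∀ ℓ j, (c.gen ℓ j).IsHermitian ∧ (supp (c.gen ℓ j)).card ≤ r ∧
    c.gen ℓ j * c.gen ℓ j = (1 / 4 : ℂ) • (1 : Op n)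

/-- `G` is an interaction graph of the layered architecture, with gate locality `r`.

* An entangling layer makes a qubit interact only with its neighbours: in the Heisenberg picture an
  operator on qubit `q` becomes an operator on `q` and its neighbours.
* The rotations of a layer form one round of `r`-local gates: each acts inside a block of qubits of
  diameter less than `r` (such as a connected set of at most `r` qubits), and those acting in
  different blocks commute (as they do if the blocks are disjoint). -/
structure IsInteractionGraph (G : SimpleGraph (Fin n)) (r : ℕ) : Prop where
  entangler : ∀ (ℓ : Fin c.depth) (q : Fin n) (A : Op n), supp A ⊆ {q} →
    ∀ p ∈ supp ((c.ent ℓ : Op n)ᴴ * A * (c.ent ℓ : Op n)), p = q ∨ G.Adj q p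
  rotations : ∀ ℓ : Fin c.depth, ∃ block : Fin (c.gates ℓ) → Finset (Fin n),
    (∀ j, supp (c.gen ℓ j) ⊆ block j) ∧
    (∀ j, ∀ p ∈ block j, ∀ q ∈ block j, G.edist p q < r) ∧
    (∀ i j, block i ≠ block j → Commute (c.gen ℓ i) (c.gen ℓ j))

end Circuit

/-- The Hessian entry `∂²f/∂θ_a∂θ_b`. -/
def hessianEntry {ι : Type} [DecidableEq ι] (f : (ι → ℝ) → ℝ) (a b : ι) (θ : ι → ℝ) : ℝ :=
  lineDeriv ℝ (fun θ' => lineDeriv ℝ f θ' (Pi.single b 1)) θ (Pi.single a 1)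

/-! ### Balls and growth of a graph -/

open Classical in
/-- The ball `B_G(v, m)`. -/
def ball {n : ℕ} (G : SimpleGraph (Fin n)) (v : Fin n) (m : ℕ) : Finset (Fin n) :=
  Finset.univ.filter fun w => G.edist v w ≤ m

/-- The growth function `V_G(m) = max_v |B_G(v, m)|`. -/
def growth {n : ℕ} (G : SimpleGraph (Fin n)) (m : ℕ) : ℕ :=
  Finset.univ.sup fun v => (ball G v m).card

/-- `k`-local terms attached to the vertices of `G`: `O v` is a normalized observable that acts on
at most `k` qubits, all of them within distance `k` of `v`. -/
structure IsLocalTerms {n : ℕ} (G : SimpleGraph (Fin n)) (k : ℕ) (O : Fin n → Op n) : Prop where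
  normalized : ∀ v, IsNormalizedObservable (O v)
  card_le : ∀ v, (supp (O v)).card ≤ k
  near : ∀ v, supp (O v) ⊆ ball G v k

/-! ### Families of circuits -/

/-- A family of circuits on `n i → ∞` qubits with two-point-spectrum generators on at most `r`
qubits and depth `L i` such that `r L i = o(n i)`. -/
structure IsAdmissibleFamily (r : ℕ) (n : ℕ → ℕ) (c : (i : ℕ) → Circuit (n i)) : Prop where
  pos : ∀ i, 0 < n i
  tendsto : Tendsto n atTop atTop
  generators : ∀ i, (c i).HasTwoPointGenerators r
  depth : (fun i => (r : ℝ) * ((c i).depth : ℝ)) =o[atTop] fun i => (n i : ℝ)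

/-- The supports of the observables grow linearly with the number of qubits. -/
def IsGlobalFamily (n : ℕ → ℕ) (O : (i : ℕ) → Op (n i)) : Prop :=
  ∃ a : ℝ, 0 < a ∧ ∀ᶠ i in atTop, a * (n i : ℝ) ≤ ((supp (O i)).card : ℝ)

end PQC

end

noncomputable section

namespace PQC

/-! ### Supports and commutation -/

/-! The core is the inequality `Var (H_ab) ≤ Var C`, valid for every circuit and all `a, b`. Since
`2G` is an involution, a gate is a combination of `cos (t/2)` and `sin (t/2)`, so in each single
parameter the cost has the form `α + β cos + γ sin`. Its partial derivative is then exactly half the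
difference of two copies shifted by `±π/2`. Shifts preserve the uniform law modulo `2π`, so both
copies have the variance of the cost, and the parallelogram identity bounds the variance of the
half-difference by it. The derivative is again of the same form, so the argument applies twice
(`IsTrigCost.variance_hessianEntry_le`). Part (i) follows with unchanged constants.

For part (ii) it remains to bound the variance of the averaged cost. In the Heisenberg picture one
layer enlarges a support by at most `max r 1` in graph distance, so each local term depends only on
the angles in a light cone (`heisenberg_lightCone`). Terms with disjoint cones are independent.
Every covariance is at most `1`, and each term is correlated with at most `k V_G(k + 2rL)` others,
so the double sum of covariances divided by `n²` is at most `k V_G(k + 2rL) / n`. -/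

lemma mem_supp {n : ℕ} {A : Op n} {q : Fin n} : q ∈ supp A ↔ ¬ ActsTriviallyAt A q := by
  simp [supp]

lemma notMem_supp {n : ℕ} {A : Op n} {q : Fin n} : q ∉ supp A ↔ ActsTriviallyAt A q := by
  simp [supp]

lemma apply_piecewise_of_actsTriviallyAt {n : ℕ} {A : Op n} (T : Finset (Fin n))
    (h : ∀ q ∈ T, ActsTriviallyAt A q) (x y z : Bits n) (hxy : ∀ q ∈ T, x q = y q) :
    A (T.piecewise z x) (T.piecewise z y) = A x y := by
  induction T using Finset.induction_on with
  | empty => simp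
  | insert j s hj ih =>
    rw [Finset.piecewise_insert, Finset.piecewise_insert, (h j (by simp)).2]
    · exact ih (fun q hq => h q (by simp [hq])) (fun q hq => hxy q (by simp [hq]))
    · simp [hj, hxy j]

/-- Operators with disjoint supports commute. -/
lemma commute_of_forall_actsTriviallyAt_or {n : ℕ} {A B : Op n}
    (h : ∀ q, ActsTriviallyAt A q ∨ ActsTriviallyAt B q) : Commute A B := by
  classical
  set T : Finset (Fin n) := Finset.univ.filter fun q => ActsTriviallyAt A q with hT
  have hA : ∀ q ∈ T, ActsTriviallyAt A q := fun q hq => by simpa [hT] using hq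
  have hB : ∀ q ∈ Tᶜ, ActsTriviallyAt B q := fun q hq =>
    (h q).resolve_left (by simpa [hT] using hq)
  have eqA : ∀ x y, A x y ≠ 0 → ∀ q ∈ T, x q = y q := fun x y hxy q hq => by
    by_contra hne
    exact hxy ((hA q hq).1 x y hne)
  have eqB : ∀ x y, B x y ≠ 0 → ∀ q ∉ T, x q = y q := fun x y hxy q hq => by
    by_contra hne
    exact hxy ((hB q (by simpa using hq)).1 x y hne)
  ext x y
  -- `A` preserves the bits in `T` and `B` those outside `T`, so a single intermediate label
  -- survives in each product: `x` on `T` and `y` elsewhere for `A * B`, and the reverse for `B *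
  -- A`.
  rw [Matrix.mul_apply, Matrix.mul_apply,
    Finset.sum_eq_single (T.piecewise x y), Finset.sum_eq_single (T.piecewise y x)]
  · have h1 := apply_piecewise_of_actsTriviallyAt T hA x (T.piecewise x y) y
      (fun q hq => by simp [hq])
    have h2 := apply_piecewise_of_actsTriviallyAt Tᶜ hB (T.piecewise x y) y x
      (fun q hq => by simp [Finset.mem_compl.1 hq])
    have e1 : T.piecewise y (T.piecewise x y) = y := by
      ext q; by_cases hq : q ∈ T <;> simp [hq]
    have e2 : Tᶜ.piecewise x (T.piecewise x y) = x := by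
      ext q; by_cases hq : q ∈ T <;> simp [hq]
    have e3 : Tᶜ.piecewise x y = T.piecewise y x := by
      ext q; by_cases hq : q ∈ T <;> simp [hq]
    rw [e1] at h1
    rw [e2, e3] at h2
    rw [h1, h2, mul_comm]
  · intro z _ hz
    by_contra hne
    refine hz ?_
    ext q
    by_cases hq : q ∈ T
    · simp [hq, eqA _ _ (right_ne_zero_of_mul hne) q hq]
    · simp [hq, eqB _ _ (left_ne_zero_of_mul hne) q hq]
  · simp
  · intro z _ hz
    by_contra hne
    refine hz ?_
    ext q
    by_cases hq : q ∈ T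
    · simp [hq, eqA _ _ (left_ne_zero_of_mul hne) q hq]
    · simp [hq, eqB _ _ (right_ne_zero_of_mul hne) q hq]
  · simp

lemma commute_of_disjoint_supp {n : ℕ} {A B : Op n} (h : Disjoint (supp A) (supp B)) :
    Commute A B :=
  commute_of_forall_actsTriviallyAt_or fun q => by
    by_cases hq : q ∈ supp A
    · exact Or.inr (notMem_supp.1 (Finset.disjoint_left.1 h hq))
    · exact Or.inl (notMem_supp.1 hq)

open Classical in
/-- The matrix unit `|a⟩⟨b|` on qubit `q`, tensored with the identity on the other qubits. -/
def matrixUnitAt {n : ℕ} (q : Fin n) (a b : Fin 2) : Op n :=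
  fun x y => if x q = a ∧ y = Function.update x q b then 1 else 0

lemma supp_matrixUnitAt {n : ℕ} (q : Fin n) (a b : Fin 2) : supp (matrixUnitAt q a b) ⊆ {q} := by
  intro p hp
  rw [mem_supp] at hp
  by_contra hpq
  rw [Finset.mem_singleton] at hpq
  refine hp ⟨fun x y hxy => ?_, fun x y c hxy => ?_⟩
  · rw [matrixUnitAt, if_neg]
    rintro ⟨-, rfl⟩
    simp [hpq] at hxy
  · have : (Function.update y p c = Function.update (Function.update x p c) q b) ↔
        y = Function.update x q b := by
      rw [Function.update_comm hpq]
      constructor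
      · intro h
        ext i
        by_cases hi : i = p
        · subst hi; simp [hpq, hxy]
        · have := congrFun h i
          simpa [hi] using congrArg Fin.val this
      · rintro rfl; rfl
    simp only [matrixUnitAt, this, Function.update_of_ne (Ne.symm hpq)]

lemma matrixUnitAt_mul_apply {n : ℕ} (q : Fin n) (a b : Fin 2) (A : Op n) (x y : Bits n) :
    (matrixUnitAt q a b * A) x y = if x q = a then A (Function.update x q b) y else 0 := by
  rw [Matrix.mul_apply, Finset.sum_eq_single (Function.update x q b)]
  · simp [matrixUnitAt]
  · intro z _ hz; simp [matrixUnitAt, hz]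
  · simp

lemma mul_matrixUnitAt_apply {n : ℕ} (q : Fin n) (a b : Fin 2) (A : Op n) (x y : Bits n) :
    (A * matrixUnitAt q a b) x y = if y q = b then A x (Function.update y q a) else 0 := by
  rw [Matrix.mul_apply, Finset.sum_eq_single (Function.update y q a)]
  · by_cases h : y q = b
    · subst h; simp [matrixUnitAt]
    · rw [if_neg h, matrixUnitAt, if_neg, mul_zero]
      rintro ⟨-, h'⟩
      apply h
      have := congrFun h' q
      simpa using this
  · intro z _ hz
    rw [matrixUnitAt, if_neg, mul_zero]
    rintro ⟨rfl, rfl⟩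
    simp at hz
  · simp

/-- An operator acts trivially at `q` iff it commutes with every operator on `q`. -/
lemma actsTriviallyAt_iff_commute {n : ℕ} {A : Op n} {q : Fin n} :
    ActsTriviallyAt A q ↔ ∀ B : Op n, supp B ⊆ {q} → Commute A B := by
  constructor
  · intro h B hB
    refine commute_of_disjoint_supp (Finset.disjoint_left.2 fun p hp hp' => ?_)
    have := Finset.mem_singleton.1 (hB hp')
    subst this
    exact mem_supp.1 hp h
  · intro h
    -- Entries of the commutation relation with a matrix unit. Taking `a = b = x q` gives vanishing
    -- off the diagonal at `q`; `a = x q` with `b` arbitrary gives independence of the common bit.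
    have key : ∀ (x y : Bits n) (a b : Fin 2),
        (if x q = a then A (Function.update x q b) y else 0) =
          if y q = b then A x (Function.update y q a) else 0 := fun x y a b => by
      rw [← matrixUnitAt_mul_apply, ← mul_matrixUnitAt_apply]
      exact congrFun (congrFun (h _ (supp_matrixUnitAt q a b)).symm x) y
    refine ⟨fun x y hxy => ?_, fun x y b hxy => ?_⟩
    · simpa [hxy.symm] using key x y (x q) (x q)
    · simpa [hxy] using key x (Function.update y q b) (x q) b

lemma ActsTriviallyAt.mul {n : ℕ} {A B : Op n} {q : Fin n} (hA : ActsTriviallyAt A q)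
    (hB : ActsTriviallyAt B q) : ActsTriviallyAt (A * B) q := by
  rw [actsTriviallyAt_iff_commute] at *
  exact fun C hC => (hA C hC).mul_left (hB C hC)

lemma actsTriviallyAt_one {n : ℕ} (q : Fin n) : ActsTriviallyAt (1 : Op n) q :=
  actsTriviallyAt_iff_commute.2 fun C _ => Commute.one_left C

lemma ActsTriviallyAt.conjTranspose {n : ℕ} {A : Op n} {q : Fin n} (hA : ActsTriviallyAt A q) :
    ActsTriviallyAt Aᴴ q := by
  refine ⟨fun x y h => ?_, fun x y b h => ?_⟩
  · simp [Matrix.conjTranspose_apply, hA.1 y x h.symm]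
  · simp [Matrix.conjTranspose_apply, hA.2 y x b h.symm]

lemma ActsTriviallyAt.listProd {n : ℕ} {l : List (Op n)} {q : Fin n}
    (h : ∀ A ∈ l, ActsTriviallyAt A q) : ActsTriviallyAt l.prod q := by
  induction l with
  | nil => simpa using actsTriviallyAt_one q
  | cons A l ih =>
    rw [List.prod_cons]
    exact (h A (by simp)).mul (ih fun B hB => h B (by simp [hB]))

/-- If conjugation by a unitary `V` maps operators on `q` to operators on `N q`, then it maps an
operator with support `S` to an operator acting on the union of the `N q` for `q ∈ S`. -/
lemma exists_mem_of_mem_supp_conj {n : ℕ} {V : Op n} (hV : V ∈ Matrix.unitaryGroup (Bits n) ℂ)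
    {N : Fin n → Fin n → Prop}
    (h : ∀ (q : Fin n) (A : Op n), supp A ⊆ {q} → ∀ p ∈ supp (Vᴴ * A * V), N q p)
    (A : Op n) {p : Fin n} (hp : p ∈ supp (Vᴴ * A * V)) : ∃ q ∈ supp A, N q p := by
  have h1 : Vᴴ * V = 1 := Matrix.mem_unitaryGroup_iff'.1 hV
  have h2 : V * Vᴴ = 1 := Matrix.mem_unitaryGroup_iff.1 hV
  have conj : ∀ X Y : Op n, Commute (Vᴴ * X * V) Y ↔ Commute X (V * Y * Vᴴ) := by
    intro X Y
    constructor
    · intro hc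
      calc X * (V * Y * Vᴴ) = (V * Vᴴ) * X * V * Y * Vᴴ := by simp only [h2, one_mul, mul_assoc]
        _ = V * (Vᴴ * X * V * Y) * Vᴴ := by simp only [mul_assoc]
        _ = V * (Y * (Vᴴ * X * V)) * Vᴴ := by rw [hc.eq]
        _ = V * Y * Vᴴ * X * (V * Vᴴ) := by simp only [mul_assoc]
        _ = V * Y * Vᴴ * X := by rw [h2, mul_one]
    · intro hc
      calc Vᴴ * X * V * Y = Vᴴ * X * V * Y * (Vᴴ * V) := by rw [h1, mul_one]
        _ = Vᴴ * (X * (V * Y * Vᴴ)) * V := by simp only [mul_assoc]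
        _ = Vᴴ * (V * Y * Vᴴ * X) * V := by rw [hc.eq]
        _ = (Vᴴ * V) * Y * (Vᴴ * X * V) := by simp only [mul_assoc]
        _ = Y * (Vᴴ * X * V) := by rw [h1, one_mul]
  by_contra hcon
  push Not at hcon
  -- Passing to commutants reduces everything to one-qubit operators, with no expansion of `A` in
  -- products: for `B` on `p` and `q ∈ supp A`, `V B Vᴴ` commutes with each `A'` on `q` because `Vᴴ
  -- A' V` does not reach `p`.
  refine mem_supp.1 hp (actsTriviallyAt_iff_commute.2 fun B hB => ?_)
  rw [conj]
  refine commute_of_disjoint_supp (Finset.disjoint_left.2 fun q hq => ?_)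
  refine notMem_supp.2 (actsTriviallyAt_iff_commute.2 fun A' hA' => ?_)
  refine Commute.symm ((conj _ _).1 ?_)
  refine commute_of_disjoint_supp (Finset.disjoint_left.2 fun p' hp' hB' => ?_)
  obtain rfl := Finset.mem_singleton.1 (hB hB')
  exact hcon q hq (h q A' hA' _ hp')

/-! ### Rotation gates -/

/-- The rotation `exp(-i t G)`. -/
def gate {n : ℕ} (G : Op n) (t : ℝ) : Op n := NormedSpace.exp ((-Complex.I * (t : ℂ)) • G)

lemma exp_smul_of_mul_self_eq_one {n : ℕ} {X : Op n} (hX : X * X = 1) (z : ℂ) :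
    NormedSpace.exp (z • X) = Complex.cosh z • (1 : Op n) + Complex.sinh z • X := by
  let _ : NormedRing (Op n) := Matrix.linftyOpNormedRing
  let _ : NormedAlgebra ℂ (Op n) := Matrix.linftyOpNormedAlgebra
  have h : HasSum (fun m : ℕ => ((m.factorial : ℂ)⁻¹) • (z • X) ^ m) (NormedSpace.exp (z • X)) :=
    NormedSpace.exp_series_hasSum_exp' (𝕂 := ℂ) (z • X)
  have he : ∀ m : ℕ, X ^ (2 * m) = 1 := fun m => by rw [pow_mul, pow_two, hX, one_pow]
  refine h.unique (HasSum.even_add_odd ?_ ?_)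
  · refine ((Complex.hasSum_cosh z).smul_const (1 : Op n)).congr_fun ?_
    intro m
    rw [smul_pow, he, smul_smul, div_eq_inv_mul]
  · refine ((Complex.hasSum_sinh z).smul_const X).congr_fun ?_
    intro m
    rw [smul_pow, pow_succ X, he, one_mul, smul_smul, div_eq_inv_mul]

/-- As `2G` squares to the identity, the exponential series splits into a scalar even part and an
odd part proportional to `G`, at half the angle. -/
lemma gate_eq {n : ℕ} {G : Op n} (hG : G * G = (1 / 4 : ℂ) • (1 : Op n)) (t : ℝ) :
    gate G t = ((Real.cos (t / 2) : ℝ) : ℂ) • (1 : Op n) +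
      ((Real.sin (t / 2) : ℝ) : ℂ) • ((-2 * Complex.I) • G) := by
  have hX : ((2 : ℂ) • G) * ((2 : ℂ) • G) = 1 := by
    rw [smul_mul_smul_comm, hG, smul_smul]; norm_num
  have h := exp_smul_of_mul_self_eq_one hX (((-(t / 2) : ℝ) : ℂ) * Complex.I)
  rw [Complex.cosh_mul_I, Complex.sinh_mul_I, smul_smul, smul_smul] at h
  rw [gate, smul_smul]
  convert h using 2
  · congr 1; push_cast; ring
  · push_cast; rw [Complex.cos_neg]
  · congr 1; push_cast; rw [Complex.sin_neg]; ring

lemma continuous_gate {n : ℕ} {G : Op n} (hG : G * G = (1 / 4 : ℂ) • (1 : Op n)) :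
    Continuous (gate G) := by
  rw [show gate G = _ from funext (gate_eq hG)]
  fun_prop

lemma gate_mem_unitaryGroup {n : ℕ} {G : Op n} (hH : G.IsHermitian)
    (hG : G * G = (1 / 4 : ℂ) • (1 : Op n)) (t : ℝ) :
    gate G t ∈ Matrix.unitaryGroup (Bits n) ℂ := by
  rw [Matrix.mem_unitaryGroup_iff, gate_eq hG, Matrix.star_eq_conjTranspose]
  simp only [Matrix.conjTranspose_add, Matrix.conjTranspose_smul, Matrix.conjTranspose_one, hH.eq,
    mul_add, add_mul, smul_mul_smul_comm, mul_one, one_mul, hG, smul_smul]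
  have h : ((Real.cos (t / 2) : ℝ) : ℂ) ^ 2 + ((Real.sin (t / 2) : ℝ) : ℂ) ^ 2 = 1 := by
    exact_mod_cast Real.cos_sq_add_sin_sq (t / 2)
  have hI := Complex.I_mul_I
  simp only [Complex.star_def, map_mul, map_neg, Complex.conj_ofReal, Complex.conj_I, map_ofNat]
  generalize ((Real.cos (t / 2) : ℝ) : ℂ) = x at *
  generalize ((Real.sin (t / 2) : ℝ) : ℂ) = y at *
  match_scalars
  · linear_combination h - y ^ 2 * hI
  · ring

lemma ActsTriviallyAt.gate {n : ℕ} {G : Op n} {q : Fin n} (hG : ActsTriviallyAt G q) (t : ℝ) :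
    ActsTriviallyAt (gate G t) q := by
  let _ : NormedRing (Op n) := Matrix.linftyOpNormedRing
  let _ : NormedAlgebra ℂ (Op n) := Matrix.linftyOpNormedAlgebra
  let _ : NormedAlgebra ℚ (Op n) := NormedAlgebra.restrictScalars ℚ ℂ (Op n)
  rw [actsTriviallyAt_iff_commute] at *
  exact fun B hB => ((hG B hB).smul_left _).exp_left

lemma Commute.gate {n : ℕ} {G G' : Op n} (h : Commute G G') (t t' : ℝ) :
    Commute (gate G t) (gate G' t') := by
  let _ : NormedRing (Op n) := Matrix.linftyOpNormedRing
  let _ : NormedAlgebra ℂ (Op n) := Matrix.linftyOpNormedAlgebra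
  let _ : NormedAlgebra ℚ (Op n) := NormedAlgebra.restrictScalars ℚ ℂ (Op n)
  exact ((h.smul_left _).smul_right _).exp

/-! ### Dependence of the cost on a single parameter -/

lemma exists_prod_ofFn_update {M : Type*} [Monoid M] {m : ℕ} (f : Fin m → M) (j : Fin m) :
    ∃ A B : M, ∀ x, (List.ofFn (Function.update f j x)).prod = A * x * B := by
  induction m with
  | zero => exact j.elim0
  | succ m ih =>
    induction j using Fin.cases with
    | zero =>
      refine ⟨1, (List.ofFn fun i => f (Fin.succ i)).prod, fun x => ?_⟩
      simp [List.ofFn_succ]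
    | succ j =>
      obtain ⟨A, B, h⟩ := ih (fun i => f i.succ) j
      refine ⟨f 0 * A, B, fun x => ?_⟩
      have h0 : (fun i : Fin m => Function.update f j.succ x i.succ) =
          Function.update (fun i => f i.succ) j x := by
        ext i
        by_cases hi : i = j
        · subst hi; simp
        · simp [hi]
      rw [List.ofFn_succ, List.prod_cons, h0, h, Function.update_of_ne (Fin.succ_ne_zero _).symm]
      simp only [mul_assoc]

namespace Circuit

variable {n : ℕ} (c : Circuit n)

lemma layer_eq (θ : c.Idx → ℝ) (ℓ : Fin c.depth) :
    c.layer θ ℓ = (c.ent ℓ : Op n) *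
      (List.ofFn fun j : Fin (c.gates ℓ) => gate (c.gen ℓ j) (θ ⟨ℓ, j⟩)).prod := rfl

lemma exists_unitary_update (θ : c.Idx → ℝ) (a : c.Idx) :
    ∃ A B : Op n, ∀ s : ℝ,
      c.unitary (Function.update θ a s) = A * gate (c.gen a.1 a.2) s * B := by
  obtain ⟨ℓ, j⟩ := a
  obtain ⟨A, B, h⟩ := exists_prod_ofFn_update (c.layer θ) ℓ
  obtain ⟨A', B', h'⟩ :=
    exists_prod_ofFn_update (fun i : Fin (c.gates ℓ) => gate (c.gen ℓ i) (θ ⟨ℓ, i⟩)) j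
  refine ⟨A * c.ent ℓ * A', B' * B, fun s => ?_⟩
  have e1 : c.layer (Function.update θ ⟨ℓ, j⟩ s) =
      Function.update (c.layer θ) ℓ (c.ent ℓ * (A' * gate (c.gen ℓ j) s * B')) := by
    funext ℓ'
    by_cases hℓ : ℓ' = ℓ
    · subst hℓ
      rw [Function.update_self, layer_eq, ← h']
      congr 3
      funext i
      by_cases hi : i = j
      · subst hi; simp
      · rw [Function.update_of_ne hi, Function.update_of_ne]
        intro h
        exact hi (by simpa using h)
    · rw [Function.update_of_ne hℓ, layer_eq, layer_eq]
      congr 3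
      funext i
      rw [Function.update_of_ne]
      intro h
      exact hℓ (congrArg Sigma.fst h)
  rw [unitary, e1, h]
  simp only [mul_assoc]

end Circuit

/-- `f` is a trigonometric polynomial of degree at most one in each of its variables. -/
def IsMultiTrig {ι : Type} [DecidableEq ι] (f : (ι → ℝ) → ℝ) : Prop :=
  ∀ θ a, ∃ α β γ : ℝ, ∀ s : ℝ, f (Function.update θ a s) = α + β * Real.cos s + γ * Real.sin s

namespace Circuit

variable {n : ℕ} {c : Circuit n} {r : ℕ}

/-- With all other angles fixed, the state is `cos (s/2) u + sin (s/2) w`. The cost is quadratic in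
it, and products of two half-angle functions lie in the span of `1`, `cos s`, `sin s`. -/
lemma HasTwoPointGenerators.isMultiTrig_cost (hc : c.HasTwoPointGenerators r) (O : Op n) :
    IsMultiTrig (c.cost O) := by
  intro θ a
  obtain ⟨A, B, h⟩ := c.exists_unitary_update θ a
  set u : Bits n → ℂ := (A * B) *ᵥ Pi.single 0 1 with hu
  set w : Bits n → ℂ := (A * ((-2 * Complex.I) • c.gen a.1 a.2) * B) *ᵥ Pi.single 0 1 with hw
  have hs : ∀ s : ℝ, c.state (Function.update θ a s) =
      ((Real.cos (s / 2) : ℝ) : ℂ) • u + ((Real.sin (s / 2) : ℝ) : ℂ) • w := by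
    intro s
    rw [state, h, gate_eq (hc a.1 a.2).2.2, hu, hw, ← Matrix.smul_mulVec, ← Matrix.smul_mulVec,
      ← Matrix.add_mulVec]
    congr 1
    simp only [mul_add, add_mul, mul_smul_comm, smul_mul_assoc, mul_one]
  set p := (star u ⬝ᵥ (O *ᵥ u)).re
  set q := (star u ⬝ᵥ (O *ᵥ w)).re + (star w ⬝ᵥ (O *ᵥ u)).re
  set t := (star w ⬝ᵥ (O *ᵥ w)).re
  refine ⟨(p + t) / 2, (p - t) / 2, q / 2, fun s => ?_⟩
  have hcos : Real.cos s = Real.cos (s / 2) ^ 2 - Real.sin (s / 2) ^ 2 := by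
    rw [← Real.cos_two_mul']; congr 1; ring
  have hsin : Real.sin s = 2 * Real.sin (s / 2) * Real.cos (s / 2) := by
    rw [← Real.sin_two_mul]; congr 1; ring
  have h1 := Real.cos_sq_add_sin_sq (s / 2)
  have : c.cost O (Function.update θ a s) = Real.cos (s / 2) ^ 2 * p +
      Real.cos (s / 2) * Real.sin (s / 2) * q + Real.sin (s / 2) ^ 2 * t := by
    rw [cost, hs]
    simp only [star_add, star_smul, Matrix.mulVec_add, Matrix.mulVec_smul, add_dotProduct,
      dotProduct_add, smul_dotProduct, dotProduct_smul, Complex.star_def, Complex.conj_ofReal,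
      smul_eq_mul, Complex.add_re, Complex.re_ofReal_mul]
    simp only [p, q, t]
    ring
  rw [this, hcos, hsin]
  linear_combination ((p + t) / 2) * h1

lemma HasTwoPointGenerators.continuous_unitary (hc : c.HasTwoPointGenerators r) :
    Continuous c.unitary := by
  have hl : ∀ ℓ, Continuous fun θ => c.layer θ ℓ := fun ℓ => by
    simp only [layer_eq, List.ofFn_eq_map]
    refine continuous_const.mul (continuous_list_prod _ fun j _ => ?_)
    exact (continuous_gate (hc ℓ j).2.2).comp (continuous_apply _)
  change Continuous fun θ => (List.ofFn (c.layer θ)).prod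
  simp only [List.ofFn_eq_map]
  exact continuous_list_prod _ fun ℓ _ => hl ℓ

lemma HasTwoPointGenerators.continuous_cost (hc : c.HasTwoPointGenerators r) (O : Op n) :
    Continuous (c.cost O) := by
  have hs : Continuous c.state := hc.continuous_unitary.matrix_mulVec continuous_const
  exact Complex.continuous_re.comp
    (hs.star.dotProduct (continuous_const.matrix_mulVec hs))

lemma HasTwoPointGenerators.layer_mem (hc : c.HasTwoPointGenerators r) (θ : c.Idx → ℝ)
    (ℓ : Fin c.depth) : c.layer θ ℓ ∈ Matrix.unitaryGroup (Bits n) ℂ := by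
  rw [layer_eq]
  refine mul_mem (c.ent ℓ).2 (list_prod_mem fun x hx => ?_)
  obtain ⟨j, rfl⟩ := List.mem_ofFn.1 hx
  exact gate_mem_unitaryGroup (hc ℓ j).1 (hc ℓ j).2.2 _

lemma HasTwoPointGenerators.unitary_mem (hc : c.HasTwoPointGenerators r) (θ : c.Idx → ℝ) :
    c.unitary θ ∈ Matrix.unitaryGroup (Bits n) ℂ := by
  refine list_prod_mem fun x hx => ?_
  obtain ⟨ℓ, rfl⟩ := List.mem_ofFn.1 hx
  exact hc.layer_mem θ ℓ

/-- The cost in the Heisenberg picture. -/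
lemma cost_eq (O : Op n) (θ : c.Idx → ℝ) :
    c.cost O θ = (((c.unitary θ)ᴴ * O * c.unitary θ) 0 0).re := by
  rw [cost, state, Matrix.star_mulVec, Matrix.mulVec_mulVec, ← Matrix.dotProduct_mulVec,
    Matrix.mulVec_mulVec]
  have : star (Pi.single 0 1 : Bits n → ℂ) = Pi.single 0 1 := by
    rw [← Pi.single_star, star_one]
  rw [this, Matrix.mulVec_single_one, single_one_dotProduct, mul_assoc, Matrix.col_apply]

lemma HasTwoPointGenerators.abs_cost_le (hc : c.HasTwoPointGenerators r) {O : Op n}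
    (hO : opNorm O ≤ 1) (θ : c.Idx → ℝ) : |c.cost O θ| ≤ 1 := by
  set ψ : EuclideanSpace ℂ (Bits n) := WithLp.toLp 2 (c.state θ) with hψ
  have hstar : star (c.state θ) ⬝ᵥ c.state θ = 1 := by
    rw [state, Matrix.star_mulVec, ← Matrix.dotProduct_mulVec, Matrix.mulVec_mulVec,
      ← Matrix.star_eq_conjTranspose, Matrix.mem_unitaryGroup_iff'.1 (hc.unitary_mem θ),
      Matrix.one_mulVec, ← Pi.single_star, star_one, single_one_dotProduct, Pi.single_eq_same]
  have hn : ‖ψ‖ = 1 := by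
    have h := inner_self_eq_norm_sq_to_K (𝕜 := ℂ) ψ
    rw [EuclideanSpace.inner_eq_star_dotProduct, dotProduct_comm] at h
    have h2 : ((‖ψ‖ : ℂ)) ^ 2 = 1 := by
      rw [← hstar]; exact h.symm
    have h3 : ‖ψ‖ ^ 2 = 1 := by exact_mod_cast h2
    nlinarith [norm_nonneg ψ]
  have hin : star (c.state θ) ⬝ᵥ (O *ᵥ c.state θ) =
      inner ℂ ψ (Matrix.toEuclideanCLM (𝕜 := ℂ) O ψ) := by
    rw [EuclideanSpace.inner_eq_star_dotProduct, dotProduct_comm]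
    rfl
  rw [cost, hin]
  calc |(inner ℂ ψ (Matrix.toEuclideanCLM (𝕜 := ℂ) O ψ)).re|
      ≤ ‖inner ℂ ψ (Matrix.toEuclideanCLM (𝕜 := ℂ) O ψ)‖ := Complex.abs_re_le_norm _
    _ ≤ ‖ψ‖ * ‖Matrix.toEuclideanCLM (𝕜 := ℂ) O ψ‖ := norm_inner_le_norm _ _
    _ ≤ ‖ψ‖ * (‖Matrix.toEuclideanCLM (𝕜 := ℂ) O‖ * ‖ψ‖) := by
        gcongr; exact ContinuousLinearMap.le_opNorm _ _
    _ ≤ 1 := by rw [hn, one_mul, mul_one]; exact hO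

end Circuit

/-! ### Rotation invariance of the uniform law -/

/-- The uniform law on `[0, 2π)`. -/
def uniformAngle : Measure ℝ := ProbabilityTheory.cond volume (Set.Ico 0 (2 * Real.pi))

/-- The law of i.i.d. uniform angles indexed by `ι`. -/
def uniformAngles (ι : Type) [Fintype ι] : Measure (ι → ℝ) := Measure.pi fun _ => uniformAngle

lemma volume_Ico_two_pi_ne_zero : volume (Set.Ico 0 (2 * Real.pi)) ≠ 0 := by
  simp [Real.volume_Ico, Real.pi_pos]

instance : IsProbabilityMeasure uniformAngle :=
  ProbabilityTheory.cond_isProbabilityMeasure_of_finite volume_Ico_two_pi_ne_zero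
    (by rw [Real.volume_Ico]; exact ENNReal.ofReal_ne_top)

instance (ι : Type) [Fintype ι] : IsProbabilityMeasure (uniformAngles ι) :=
  inferInstanceAs (IsProbabilityMeasure (Measure.pi _))

/-- Rotation of an angle by `s`, normalized to `[0, 2π)`. -/
def rotateAngle (s x : ℝ) : ℝ := toIcoMod Real.two_pi_pos 0 (x + s)

lemma measurable_toIcoMod_two_pi : Measurable (toIcoMod Real.two_pi_pos 0) := by
  have : toIcoMod Real.two_pi_pos 0 = fun x => Int.fract (x / (2 * Real.pi)) * (2 * Real.pi) :=
    funext (toIcoMod_eq_fract_mul Real.two_pi_pos)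
  rw [this]
  exact (measurable_fract.comp (measurable_id.div_const _)).mul_const _

/-- Up to endpoints, both intervals are fundamental domains for translation by `2πℤ`, under which
`A` is invariant. -/
lemma volume_inter_Ico_eq {A : Set ℝ} (hA : MeasurableSet A)
    (hper : ∀ x, x + 2 * Real.pi ∈ A ↔ x ∈ A) (s t : ℝ) :
    volume (A ∩ Set.Ico s (s + 2 * Real.pi)) = volume (A ∩ Set.Ico t (t + 2 * Real.pi)) := by
  have hI : ∀ u : ℝ, volume (A ∩ Set.Ico u (u + 2 * Real.pi)) =
      volume (A ∩ Set.Ioc u (u + 2 * Real.pi)) := fun u =>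
    measure_congr ((ae_eq_refl A).inter Ico_ae_eq_Ioc)
  rw [hI, hI]
  refine (isAddFundamentalDomain_Ioc Real.two_pi_pos s).measure_set_eq
    (isAddFundamentalDomain_Ioc Real.two_pi_pos t) hA fun g => ?_
  have hp : Function.Periodic (fun x => x ∈ A) (2 * Real.pi) := fun x => propext (hper x)
  ext x
  exact iff_of_eq (hp.map_vadd_zmultiples g x)

lemma measurePreserving_rotateAngle (s : ℝ) :
    MeasurePreserving (rotateAngle s) uniformAngle uniformAngle := by
  have hm : Measurable (rotateAngle s) :=
    measurable_toIcoMod_two_pi.comp (measurable_id.add_const s)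
  -- The uniform law is a multiple of Lebesgue measure on `[0, 2π)`. Translation carries this
  -- interval to `[s, s + 2π)`, and periodicity carries it back.
  refine MeasurePreserving.smul_measure ⟨hm, ?_⟩ _
  ext A hA
  rw [Measure.map_apply hm hA, Measure.restrict_apply (hm hA), Measure.restrict_apply hA]
  set A' : Set ℝ := toIcoMod Real.two_pi_pos 0 ⁻¹' A with hA'
  have hA'm : MeasurableSet A' := measurable_toIcoMod_two_pi hA
  have h1 : rotateAngle s ⁻¹' A ∩ Set.Ico 0 (2 * Real.pi) =
      (fun x => x + s) ⁻¹' (A' ∩ Set.Ico s (s + 2 * Real.pi)) := by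
    ext x
    simp only [Set.mem_inter_iff, Set.mem_preimage, Set.mem_Ico, rotateAngle, hA']
    refine and_congr_right fun _ => ?_
    constructor <;> rintro ⟨_, _⟩ <;> constructor <;> linarith
  have h2 : A ∩ Set.Ico 0 (2 * Real.pi) = A' ∩ Set.Ico 0 (0 + 2 * Real.pi) := by
    ext x
    simp only [Set.mem_inter_iff, zero_add]
    refine and_congr_left fun hx => ?_
    rw [hA', Set.mem_preimage, (toIcoMod_eq_self Real.two_pi_pos).2 (by simpa using hx)]
  rw [h1, measure_preimage_add_right, h2]
  exact volume_inter_Ico_eq hA'm (fun x => by simp [hA', toIcoMod_add_right]) _ _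

/-! ### The parameter-shift rule -/

/-- Bounded continuous functions that are trigonometric polynomials of degree at most one in each
variable. -/
structure IsTrigCost {ι : Type} [DecidableEq ι] (f : (ι → ℝ) → ℝ) : Prop where
  continuous : Continuous f
  bounded : ∃ M, ∀ θ, |f θ| ≤ M
  trig : IsMultiTrig f

/-- The function `f` with its variable `a` shifted by `s`. -/
def shiftAt {ι : Type} [DecidableEq ι] (a : ι) (s : ℝ) (f : (ι → ℝ) → ℝ) (θ : ι → ℝ) : ℝ :=
  f (Function.update θ a (θ a + s))

section

variable {ι : Type} [DecidableEq ι] {f g : (ι → ℝ) → ℝ}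

lemma IsTrigCost.memLp [Fintype ι] (hf : IsTrigCost f) : MemLp f 2 (uniformAngles ι) := by
  obtain ⟨M, hM⟩ := hf.bounded
  exact MemLp.of_bound hf.continuous.aestronglyMeasurable M (Eventually.of_forall hM)

lemma IsTrigCost.add (hf : IsTrigCost f) (hg : IsTrigCost g) : IsTrigCost fun θ => f θ + g θ := by
  refine ⟨hf.continuous.add hg.continuous, ?_, fun θ a => ?_⟩
  · obtain ⟨M, hM⟩ := hf.bounded
    obtain ⟨N, hN⟩ := hg.bounded
    exact ⟨M + N, fun θ => (abs_add_le _ _).trans (add_le_add (hM θ) (hN θ))⟩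
  · obtain ⟨α, β, γ, h⟩ := hf.trig θ a
    obtain ⟨α', β', γ', h'⟩ := hg.trig θ a
    exact ⟨α + α', β + β', γ + γ', fun s => by rw [h, h']; ring⟩

lemma IsTrigCost.const_mul (hf : IsTrigCost f) (k : ℝ) : IsTrigCost fun θ => k * f θ := by
  refine ⟨continuous_const.mul hf.continuous, ?_, fun θ a => ?_⟩
  · obtain ⟨M, hM⟩ := hf.bounded
    exact ⟨|k| * M, fun θ => by rw [abs_mul]; exact mul_le_mul_of_nonneg_left (hM θ) (abs_nonneg k)⟩
  · obtain ⟨α, β, γ, h⟩ := hf.trig θ a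
    exact ⟨k * α, k * β, k * γ, fun s => by rw [h]; ring⟩

lemma IsTrigCost.sum {κ : Type*} (t : Finset κ) {F : κ → (ι → ℝ) → ℝ}
    (hF : ∀ v, IsTrigCost (F v)) : IsTrigCost fun θ => ∑ v ∈ t, F v θ := by
  classical
  induction t using Finset.induction_on with
  | empty =>
    exact ⟨by simpa using continuous_const, ⟨0, by simp⟩, fun _ _ => ⟨0, 0, 0, by simp⟩⟩
  | insert v t hv ih => simpa only [Finset.sum_insert hv] using (hF v).add ih

lemma IsTrigCost.shiftAt (hf : IsTrigCost f) (a : ι) (s : ℝ) : IsTrigCost (shiftAt a s f) := by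
  refine ⟨?_, ?_, fun θ b => ?_⟩
  · exact hf.continuous.comp
      (continuous_id.update a ((continuous_apply a).add continuous_const))
  · obtain ⟨M, hM⟩ := hf.bounded
    exact ⟨M, fun θ => hM _⟩
  · by_cases hab : b = a
    · subst hab
      obtain ⟨α, β, γ, h⟩ := hf.trig θ b
      refine ⟨α, β * Real.cos s + γ * Real.sin s, γ * Real.cos s - β * Real.sin s, fun t => ?_⟩
      rw [PQC.shiftAt, Function.update_self, Function.update_idem, h, Real.cos_add, Real.sin_add]
      ring
    · obtain ⟨α, β, γ, h⟩ := hf.trig (Function.update θ a (θ a + s)) b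
      refine ⟨α, β, γ, fun t => ?_⟩
      rw [PQC.shiftAt, ← h, Function.update_of_ne (Ne.symm hab), Function.update_comm hab]

/-- Each variable may be reduced to `[0, 2π)`. -/
lemma IsTrigCost.shiftAt_eq_rotate (hf : IsTrigCost f) (a : ι) (s : ℝ) (θ : ι → ℝ) :
    PQC.shiftAt a s f θ = f (Function.update θ a (rotateAngle s (θ a))) := by
  obtain ⟨α, β, γ, h⟩ := hf.trig θ a
  rw [PQC.shiftAt, h, h, rotateAngle, toIcoMod, zsmul_eq_mul, Real.cos_sub_int_mul_two_pi,
    Real.sin_sub_int_mul_two_pi]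

/-- By periodicity the shift may be replaced by a rotation modulo `2π` of one coordinate, which
preserves the product law. -/
lemma IsTrigCost.variance_shiftAt [Fintype ι] (hf : IsTrigCost f) (a : ι) (s : ℝ) :
    ProbabilityTheory.variance (PQC.shiftAt a s f) (uniformAngles ι) =
      ProbabilityTheory.variance f (uniformAngles ι) := by
  have hT : MeasurePreserving
      (fun (θ : ι → ℝ) i => (if i = a then rotateAngle s else id) (θ i))
      (uniformAngles ι) (uniformAngles ι) := by
    refine measurePreserving_pi _ _ fun i => ?_
    by_cases hi : i = a
    · simpa [hi] using measurePreserving_rotateAngle s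
    · simpa [hi] using MeasurePreserving.id _
  rw [← hT.variance_fun_comp hf.continuous.aemeasurable]
  congr 1
  funext θ
  rw [hf.shiftAt_eq_rotate]
  congr 1
  funext i
  by_cases hi : i = a
  · subst hi; simp
  · simp [hi]

/-- The parameter-shift rule. -/
lemma IsMultiTrig.lineDeriv_eq (hf : IsMultiTrig f) (a : ι) (θ : ι → ℝ) :
    lineDeriv ℝ f θ (Pi.single a 1) =
      (1 / 2) * PQC.shiftAt a (Real.pi / 2) f θ + (-(1 / 2)) * PQC.shiftAt a (-(Real.pi / 2)) f θ := by
  obtain ⟨α, β, γ, h⟩ := hf θ a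
  have e : (fun t : ℝ => f (θ + t • Pi.single a 1)) =
      fun t => α + β * Real.cos (θ a + t) + γ * Real.sin (θ a + t) := by
    funext t
    rw [← h]
    congr 1
    funext i
    by_cases hi : i = a
    · subst hi; simp
    · simp [hi]
  have hd : HasDerivAt (fun t => α + β * Real.cos (θ a + t) + γ * Real.sin (θ a + t))
      (β * (-Real.sin (θ a + 0) * 1) + γ * (Real.cos (θ a + 0) * 1)) 0 := by
    have hi : HasDerivAt (fun t : ℝ => θ a + t) 1 0 := (hasDerivAt_id 0).const_add (θ a)
    exact ((hi.cos.const_mul β).const_add α).add (hi.sin.const_mul γ)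
  rw [lineDeriv, e, hd.deriv, PQC.shiftAt, PQC.shiftAt, h, h, ← sub_eq_add_neg, Real.cos_add_pi_div_two,
    Real.sin_add_pi_div_two, Real.cos_sub_pi_div_two, Real.sin_sub_pi_div_two, add_zero]
  ring

/-- Closure under differentiation lets the first-order variance bound be iterated for the Hessian.
-/
lemma IsTrigCost.lineDeriv (hf : IsTrigCost f) (a : ι) :
    IsTrigCost fun θ => lineDeriv ℝ f θ (Pi.single a 1) := by
  simp only [hf.trig.lineDeriv_eq]
  exact ((hf.shiftAt a _).const_mul _).add ((hf.shiftAt a _).const_mul _)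

lemma covariance_le_half_variance_add {Ω : Type*} [MeasurableSpace Ω] {μ : Measure Ω}
    [IsFiniteMeasure μ] {X Y : Ω → ℝ} (hX : MemLp X 2 μ) (hY : MemLp Y 2 μ) :
    ProbabilityTheory.covariance X Y μ ≤
      (ProbabilityTheory.variance X μ + ProbabilityTheory.variance Y μ) / 2 := by
  have h := ProbabilityTheory.variance_sub hX hY
  have h0 := ProbabilityTheory.variance_nonneg (X - Y) μ
  linarith

/-- Parallelogram identity for variances, with `Var (X + Y) ≥ 0` dropped; no independence of `X` and
`Y` is needed. -/
lemma variance_half_sub_half_le {Ω : Type*} [MeasurableSpace Ω] {μ : Measure Ω}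
    [IsFiniteMeasure μ] {X Y : Ω → ℝ} (hX : MemLp X 2 μ) (hY : MemLp Y 2 μ) :
    ProbabilityTheory.variance (fun ω => (1 / 2) * X ω + (-(1 / 2)) * Y ω) μ ≤
      (ProbabilityTheory.variance X μ + ProbabilityTheory.variance Y μ) / 2 := by
  have e : (fun ω => (1 / 2) * X ω + (-(1 / 2)) * Y ω) = fun ω => (1 / 2) * (X - Y) ω := by
    funext ω; simp only [Pi.sub_apply]; ring
  have h := ProbabilityTheory.variance_add hX hY
  have h0 := ProbabilityTheory.variance_nonneg (X + Y) μ
  rw [e, ProbabilityTheory.variance_const_mul, ProbabilityTheory.variance_sub hX hY]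
  linarith

lemma IsTrigCost.variance_lineDeriv_le [Fintype ι] (hf : IsTrigCost f) (a : ι) :
    ProbabilityTheory.variance (fun θ => _root_.lineDeriv ℝ f θ (Pi.single a 1))
      (uniformAngles ι) ≤ ProbabilityTheory.variance f (uniformAngles ι) := by
  simp only [hf.trig.lineDeriv_eq]
  refine (variance_half_sub_half_le (hf.shiftAt a _).memLp (hf.shiftAt a _).memLp).trans_eq ?_
  rw [hf.variance_shiftAt, hf.variance_shiftAt, add_self_div_two]

/-- The variance of a Hessian entry is at most the variance of the cost. -/
theorem IsTrigCost.variance_hessianEntry_le [Fintype ι] (hf : IsTrigCost f) (a b : ι) :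
    ProbabilityTheory.variance (hessianEntry f a b) (uniformAngles ι) ≤
      ProbabilityTheory.variance f (uniformAngles ι) :=
  ((hf.lineDeriv b).variance_lineDeriv_le a).trans (hf.variance_lineDeriv_le b)

end

namespace Circuit

variable {n : ℕ} {c : Circuit n} {r : ℕ}

lemma HasTwoPointGenerators.isTrigCost (hc : c.HasTwoPointGenerators r) {O : Op n}
    (hO : opNorm O ≤ 1) : IsTrigCost (c.cost O) :=
  ⟨hc.continuous_cost O, ⟨1, hc.abs_cost_le hO⟩, hc.isMultiTrig_cost O⟩

end Circuit

/-! ### Independence of functions of disjoint sets of angles -/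

lemma covariance_eq_zero_of_dependsOn {ι : Type} [Fintype ι] [DecidableEq ι]
    {f g : (ι → ℝ) → ℝ} (hf : IsTrigCost f) (hg : IsTrigCost g) {S T : Finset ι}
    (hST : Disjoint S T) (hfS : DependsOn f (S : Set ι)) (hgT : DependsOn g (T : Set ι)) :
    ProbabilityTheory.covariance f g (uniformAngles ι) = 0 := by
  have hind : ProbabilityTheory.iIndepFun (fun (i : ι) (θ : ι → ℝ) => θ i) (uniformAngles ι) :=
    ProbabilityTheory.iIndepFun_pi (X := fun _ => id) fun _ => aemeasurable_id
  have h := hind.indepFun_finset S T hST fun i => measurable_pi_apply i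
  -- Extension by zero exhibits `f` and `g` as functions of the restricted, independent families of
  -- angles; the filler value is irrelevant by `DependsOn`.
  let ext (U : Finset ι) (x : U → ℝ) : ι → ℝ := fun i => if hi : i ∈ U then x ⟨i, hi⟩ else 0
  have hext : ∀ U, Measurable (ext U) := fun U => measurable_pi_iff.2 fun i => by
    by_cases hi : i ∈ U
    · simpa [ext, hi] using measurable_pi_apply _
    · simp [ext, hi]
  have h' := h.comp (hf.continuous.measurable.comp (hext S)) (hg.continuous.measurable.comp (hext T))
  have ef : (f ∘ ext S) ∘ (fun (θ : ι → ℝ) (i : S) => θ i) = f := by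
    funext θ
    exact hfS fun i hi => by simp [ext, Finset.mem_coe.1 hi]
  have eg : (g ∘ ext T) ∘ (fun (θ : ι → ℝ) (i : T) => θ i) = g := by
    funext θ
    exact hgT fun i hi => by simp [ext, Finset.mem_coe.1 hi]
  rw [ef, eg] at h'
  exact h'.covariance_eq_zero hf.memLp hg.memLp

/-! ### Light cones -/

/-- The order inside each of the two groups is kept, so gates sharing a block need not commute. With
the factors satisfying `P` on the right, the others stand next to the conjugated observable and can
cancel. -/
lemma prod_map_eq_filter_mul_filter {M κ : Type*} [Monoid M] (f : κ → M) (P : κ → Prop)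
    [DecidablePred P] (h : ∀ i j, P i → ¬ P j → Commute (f i) (f j)) (l : List κ) :
    (l.map f).prod =
      ((l.filter fun i => ¬ P i).map f).prod * ((l.filter fun i => P i).map f).prod := by
  induction l with
  | nil => simp
  | cons i l ih =>
    by_cases hi : P i
    · have hcomm : Commute (f i) ((l.filter fun i => ¬ P i).map f).prod := by
        refine Commute.list_prod_right _ _ fun x hx => ?_
        obtain ⟨j, hj, rfl⟩ := List.mem_map.1 hx
        exact h i j hi (by simpa using (List.mem_filter.1 hj).2)
      rw [List.map_cons, List.prod_cons, ih, List.filter_cons_of_neg (by simpa using hi),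
        List.filter_cons_of_pos (by simpa using hi), List.map_cons, List.prod_cons, ← mul_assoc,
        hcomm.eq, mul_assoc]
    · rw [List.map_cons, List.prod_cons, ih, List.filter_cons_of_pos (by simpa using hi),
        List.filter_cons_of_neg (by simpa using hi), List.map_cons, List.prod_cons, mul_assoc]

lemma conj_eq_self_of_commute {n : ℕ} {A W : Op n} (hW : W ∈ Matrix.unitaryGroup (Bits n) ℂ)
    (h : Commute W A) : Wᴴ * A * W = A := by
  rw [mul_assoc, ← h.eq, ← mul_assoc, ← Matrix.star_eq_conjTranspose,
    Matrix.mem_unitaryGroup_iff'.1 hW, one_mul]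

/-- The strict bound `b < y` contributes only `y - 1`, the saving that block diameters less than `r`
provide. -/
lemma enat_add_le_of_le_of_lt {a b : ℕ∞} {x y z : ℕ} (ha : a ≤ x) (hb : b < y)
    (h : x + y ≤ z + 1) : a + b ≤ z := by
  lift a to ℕ using ne_top_of_le_ne_top (ENat.natCast_ne_top x) ha
  lift b to ℕ using ne_top_of_lt hb
  norm_cast at *
  omega

namespace Circuit

variable {n : ℕ} {c : Circuit n} {r : ℕ}

open Classical in
/-- The rotations of layer `ℓ` with index in `J`. -/
def rotationsIn (c : Circuit n) (ℓ : Fin c.depth) (J : Set (Fin (c.gates ℓ))) (θ : c.Idx → ℝ) :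
    Op n :=
  (((List.finRange (c.gates ℓ)).filter fun j => j ∈ J).map
    fun j => gate (c.gen ℓ j) (θ ⟨ℓ, j⟩)).prod

lemma rotationsIn_congr {ℓ : Fin c.depth} {J : Set (Fin (c.gates ℓ))} {θ θ' : c.Idx → ℝ}
    (h : ∀ j ∈ J, θ ⟨ℓ, j⟩ = θ' ⟨ℓ, j⟩) : c.rotationsIn ℓ J θ = c.rotationsIn ℓ J θ' := by
  refine congrArg List.prod (List.map_congr_left fun j hj => ?_)
  rw [h j (by simpa using (List.mem_filter.1 hj).2)]

lemma HasTwoPointGenerators.rotationsIn_mem (hc : c.HasTwoPointGenerators r) (ℓ : Fin c.depth)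
    (J : Set (Fin (c.gates ℓ))) (θ : c.Idx → ℝ) :
    c.rotationsIn ℓ J θ ∈ Matrix.unitaryGroup (Bits n) ℂ := by
  refine list_prod_mem fun x hx => ?_
  obtain ⟨j, -, rfl⟩ := List.mem_map.1 hx
  exact gate_mem_unitaryGroup (hc ℓ j).1 (hc ℓ j).2.2 _

lemma actsTriviallyAt_rotationsIn {ℓ : Fin c.depth} {J : Set (Fin (c.gates ℓ))} {q : Fin n}
    (h : ∀ j ∈ J, ActsTriviallyAt (c.gen ℓ j) q) (θ : c.Idx → ℝ) :
    ActsTriviallyAt (c.rotationsIn ℓ J θ) q := by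
  refine ActsTriviallyAt.listProd fun x hx => ?_
  obtain ⟨j, hj, rfl⟩ := List.mem_map.1 hx
  exact (h j (by simpa using (List.mem_filter.1 hj).2)).gate _

/-- Only the rotations in blocks that meet `S` act on an operator supported in `S`. -/
lemma HasTwoPointGenerators.layer_conj (hc : c.HasTwoPointGenerators r) {ℓ : Fin c.depth}
    {block : Fin (c.gates ℓ) → Finset (Fin n)} (hb : ∀ j, supp (c.gen ℓ j) ⊆ block j)
    (hcomm : ∀ i j, block i ≠ block j → Commute (c.gen ℓ i) (c.gen ℓ j))
    {A : Op n} {S : Set (Fin n)} (hA : ∀ p ∈ supp ((c.ent ℓ : Op n)ᴴ * A * (c.ent ℓ : Op n)), p ∈ S)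
    (θ : c.Idx → ℝ) :
    (c.layer θ ℓ)ᴴ * A * c.layer θ ℓ =
      (c.rotationsIn ℓ {j | ∃ q ∈ block j, q ∈ S} θ)ᴴ * ((c.ent ℓ : Op n)ᴴ * A * (c.ent ℓ : Op n)) *
        c.rotationsIn ℓ {j | ∃ q ∈ block j, q ∈ S} θ := by
  classical
  set J : Set (Fin (c.gates ℓ)) := {j | ∃ q ∈ block j, q ∈ S} with hJ
  have hl : c.layer θ ℓ = (c.ent ℓ : Op n) * (c.rotationsIn ℓ Jᶜ θ * c.rotationsIn ℓ J θ) := by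
    rw [layer_eq, List.ofFn_eq_map, prod_map_eq_filter_mul_filter _ (fun j => j ∈ J)]
    · simp only [rotationsIn, Set.mem_compl_iff]
      congr!
    · intro i j hi hj
      -- Membership in `J` is decided by the block, not by the generator's own support; hence gates
      -- inside and outside `J` have different blocks and commute.
      refine Commute.gate (hcomm i j fun hij => hj ?_) _ _
      rw [hJ, Set.mem_ofPred_eq] at hi ⊢
      rwa [← hij]
  have hcomp : Commute (c.rotationsIn ℓ Jᶜ θ) ((c.ent ℓ : Op n)ᴴ * A * (c.ent ℓ : Op n)) := by
    refine commute_of_forall_actsTriviallyAt_or fun q => ?_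
    by_cases hq : q ∈ supp ((c.ent ℓ : Op n)ᴴ * A * (c.ent ℓ : Op n))
    · refine Or.inl (actsTriviallyAt_rotationsIn (fun j hj => notMem_supp.1 fun hqj => ?_) θ)
      exact hj ⟨q, hb j hqj, hA q hq⟩
    · exact Or.inr (notMem_supp.1 hq)
  calc (c.layer θ ℓ)ᴴ * A * c.layer θ ℓ
      = (c.rotationsIn ℓ J θ)ᴴ * ((c.rotationsIn ℓ Jᶜ θ)ᴴ * ((c.ent ℓ : Op n)ᴴ * A * (c.ent ℓ : Op n)) *
          c.rotationsIn ℓ Jᶜ θ) * c.rotationsIn ℓ J θ := by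
        rw [hl]; simp only [Matrix.conjTranspose_mul, mul_assoc]
    _ = _ := by rw [conj_eq_self_of_commute (hc.rotationsIn_mem ℓ _ θ) hcomp]

/-- The observable in the Heisenberg picture after the first `m` layers. -/
def heisenberg (c : Circuit n) (O : Op n) (m : ℕ) (θ : c.Idx → ℝ) : Op n :=
  ((List.ofFn (c.layer θ)).take m).prodᴴ * O * ((List.ofFn (c.layer θ)).take m).prod

lemma heisenberg_succ (O : Op n) (ℓ : Fin c.depth) (θ : c.Idx → ℝ) :
    c.heisenberg O (ℓ + 1) θ = (c.layer θ ℓ)ᴴ * c.heisenberg O ℓ θ * c.layer θ ℓ := by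
  rw [heisenberg, heisenberg, List.prod_take_succ _ _ (by simp)]
  simp only [Matrix.conjTranspose_mul, mul_assoc, List.getElem_ofFn]

lemma cost_eq_heisenberg (O : Op n) (θ : c.Idx → ℝ) :
    c.cost O θ = (c.heisenberg O c.depth θ 0 0).re := by
  rw [cost_eq, heisenberg, List.take_of_length_le (by simp), unitary]

/-- The parameters of the backward light cone of a set of qubits, where `R` bounds the expansion of
supports per layer. -/
def lightCone (c : Circuit n) (G : SimpleGraph (Fin n))
    (block : (ℓ : Fin c.depth) → Fin (c.gates ℓ) → Finset (Fin n)) (R : ℕ) (S : Finset (Fin n)) :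
    Set c.Idx :=
  {a | ∃ p ∈ S, ∃ q ∈ block a.1 a.2, G.edist p q ≤ (R * a.1 + 1 : ℕ)}

variable {G : SimpleGraph (Fin n)} {block : (ℓ : Fin c.depth) → Fin (c.gates ℓ) → Finset (Fin n)}

/-- Induction on layers. The entangler adds distance `1` and a block at most `r - 1`, in total at
most `R`. The two claims go together: the support bound determines which rotations of the next layer
act at all. -/
lemma HasTwoPointGenerators.heisenberg_lightCone (hc : c.HasTwoPointGenerators r)
    (hent : ∀ (ℓ : Fin c.depth) (q : Fin n) (A : Op n), supp A ⊆ {q} →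
      ∀ p ∈ supp ((c.ent ℓ : Op n)ᴴ * A * (c.ent ℓ : Op n)), p = q ∨ G.Adj q p)
    (hb : ∀ ℓ j, supp (c.gen ℓ j) ⊆ block ℓ j)
    (hdiam : ∀ ℓ j, ∀ p ∈ block ℓ j, ∀ q ∈ block ℓ j, G.edist p q < r)
    (hcomm : ∀ ℓ i j, block ℓ i ≠ block ℓ j → Commute (c.gen ℓ i) (c.gen ℓ j))
    {R : ℕ} (hR : 1 ≤ R) (hrR : r ≤ R) (O : Op n) {m : ℕ} (hm : m ≤ c.depth) :
    (∀ θ, ∀ p ∈ supp (c.heisenberg O m θ), ∃ q ∈ supp O, G.edist q p ≤ (R * m : ℕ)) ∧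
      DependsOn (c.heisenberg O m) (c.lightCone G block R (supp O)) := by
  induction m with
  | zero =>
    refine ⟨fun θ p hp => ⟨p, by simpa [heisenberg] using hp, by simp⟩, fun θ θ' _ => ?_⟩
    simp [heisenberg]
  | succ m ih =>
    obtain ⟨hs, hd⟩ := ih (by omega)
    set ℓ : Fin c.depth := ⟨m, hm⟩
    -- The region reachable between the entangler and the rotations of this layer, whence the `+ 1`
    -- in `lightCone`. Unlike the actual support it is independent of `θ`, so the same rotations are
    -- retained for all parameters.
    set S : Set (Fin n) := {p | ∃ q ∈ supp O, G.edist q p ≤ (R * m + 1 : ℕ)} with hS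
    have hsupp : ∀ θ, ∀ p ∈ supp ((c.ent ℓ : Op n)ᴴ * c.heisenberg O m θ * (c.ent ℓ : Op n)), p ∈ S := by
      intro θ p hp
      obtain ⟨q', hq', hN⟩ := exists_mem_of_mem_supp_conj (c.ent ℓ).2
        (N := fun q p => p = q ∨ G.Adj q p) (hent ℓ) _ hp
      obtain ⟨q, hq, hqq'⟩ := hs θ q' hq'
      refine ⟨q, hq, SimpleGraph.edist_triangle.trans (enat_add_le_of_le_of_lt hqq'
        (y := 2) ?_ le_rfl)⟩
      rcases hN with rfl | hadj
      · simp
      · rw [SimpleGraph.edist_eq_one_iff_adj.2 hadj]; norm_num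
    have hstep : ∀ θ, c.heisenberg O (m + 1) θ = _ := fun θ =>
      (heisenberg_succ O ℓ θ).trans (hc.layer_conj (hb ℓ) (hcomm ℓ) (hsupp θ) θ)
    set J : Set (Fin (c.gates ℓ)) := {j | ∃ q ∈ block ℓ j, q ∈ S} with hJ
    refine ⟨fun θ p hp => ?_, fun θ θ' h => ?_⟩
    · by_contra hcon
      push Not at hcon
      rw [hstep, mem_supp] at hp
      have hfar : ∀ q ∈ supp O, ∀ t : ℕ, t ≤ R * (m + 1) → ¬ G.edist q p ≤ t := by
        intro q hq t ht h
        exact absurd (h.trans (by exact_mod_cast ht)) (not_le.2 (hcon q hq))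
      have hrot : ActsTriviallyAt (c.rotationsIn ℓ J θ) p := by
        refine actsTriviallyAt_rotationsIn (fun j hj => notMem_supp.1 fun hpj => ?_) θ
        obtain ⟨q', hq', q, hq, hqq'⟩ := hj
        refine hfar q hq (R * (m + 1)) le_rfl (SimpleGraph.edist_triangle.trans
          (enat_add_le_of_le_of_lt hqq' (hdiam ℓ j q' hq' p (hb ℓ j hpj)) ?_))
        rw [mul_add]
        omega
      refine hp ((hrot.conjTranspose.mul (notMem_supp.1 fun hpS => ?_)).mul hrot)
      obtain ⟨q, hq, hqp⟩ := hsupp θ p hpS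
      exact hfar q hq _ (by rw [mul_add]; omega) hqp
    · rw [hstep, hstep, hd h, rotationsIn_congr]
      rintro j ⟨q', hq', q, hq, hqq'⟩
      exact h ⟨ℓ, j⟩ ⟨q, hq, q', hq', hqq'⟩

end Circuit

/-! ### Variance of local costs -/

namespace Circuit

variable {n : ℕ} {c : Circuit n} {r k : ℕ} {G : SimpleGraph (Fin n)}

/-- Local costs are uncorrelated unless the supports of their observables are at distance at most
`2 r L`. -/
lemma HasTwoPointGenerators.covariance_cost_eq_zero (hc : c.HasTwoPointGenerators r)
    (hG : c.IsInteractionGraph G r) {A B : Op n} (hA : opNorm A ≤ 1) (hB : opNorm B ≤ 1)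
    (hfar : ∀ p ∈ supp A, ∀ q ∈ supp B, ¬ G.edist p q ≤ (2 * r * c.depth : ℕ)) :
    ProbabilityTheory.covariance (c.cost A) (c.cost B) (uniformAngles c.Idx) = 0 := by
  classical
  choose block hb hdiam hcomm using hG.rotations
  have hdep : ∀ O : Op n, DependsOn (c.cost O)
      ((c.lightCone G block (max r 1) (supp O)).toFinset : Set c.Idx) := fun O θ θ' h => by
    rw [cost_eq_heisenberg, cost_eq_heisenberg,
      (hc.heisenberg_lightCone hG.entangler hb hdiam hcomm (le_max_right r 1) (le_max_left r 1) O
        le_rfl).2 (by simpa using h)]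
  refine covariance_eq_zero_of_dependsOn (hc.isTrigCost hA) (hc.isTrigCost hB) ?_ (hdep A) (hdep B)
  rw [Set.disjoint_toFinset, Set.disjoint_left]
  rintro ⟨ℓ, j⟩ ⟨p, hp, p', hp', hpp'⟩ ⟨q, hq, q', hq', hqq'⟩
  have hd := hdiam ℓ j p' hp' q' hq'
  -- A shared gate has a nonempty block, which is impossible for `r = 0`.
  have hr : 1 ≤ r := by
    by_contra hr0
    obtain rfl : r = 0 := by omega
    simp at hd
  rw [max_eq_left hr] at hpp' hqq'
  dsimp only at hpp' hqq'
  rw [SimpleGraph.edist_comm] at hqq'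
  -- A shared gate in layer `ℓ` joins the supports by a path of length at most `(rℓ + 1) + (r - 1) +
  -- (rℓ + 1)`, and `ℓ + 1 ≤ L` with `r ≥ 1` bounds this by `2rL`.
  refine hfar p hp q hq (SimpleGraph.edist_triangle.trans (enat_add_le_of_le_of_lt
    (x := r * ℓ + r) (y := r * ℓ + 2)
    (SimpleGraph.edist_triangle.trans (enat_add_le_of_le_of_lt hpp' hd (by omega)))
    (hqq'.trans_lt (by norm_cast; omega)) ?_))
  have : r * (ℓ + 1) ≤ r * c.depth := Nat.mul_le_mul_left r ℓ.2
  rw [mul_add] at this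
  rw [mul_assoc]
  omega

lemma HasTwoPointGenerators.isTrigCost_averagedCost (hc : c.HasTwoPointGenerators r)
    {O : Fin n → Op n} (hO : ∀ v, opNorm (O v) ≤ 1) : IsTrigCost (c.averagedCost O) :=
  (IsTrigCost.sum Finset.univ fun v => hc.isTrigCost (hO v)).const_mul _

lemma HasTwoPointGenerators.covariance_cost_le_one (hc : c.HasTwoPointGenerators r)
    {A B : Op n} (hA : opNorm A ≤ 1) (hB : opNorm B ≤ 1) :
    ProbabilityTheory.covariance (c.cost A) (c.cost B) (uniformAngles c.Idx) ≤ 1 := by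
  have hvar : ∀ O : Op n, opNorm O ≤ 1 →
      ProbabilityTheory.variance (c.cost O) (uniformAngles c.Idx) ≤ 1 := fun O hO => by
    -- Values in `[-1, 1]` have variance at most the square of half the range.
    have h := ProbabilityTheory.variance_le_sq_of_bounded (μ := uniformAngles c.Idx)
      (a := -1) (b := 1) (Eventually.of_forall fun θ => abs_le.1 (hc.abs_cost_le hO θ))
      (hc.continuous_cost O).aemeasurable
    norm_num at h
    exact h
  have h := covariance_le_half_variance_add (hc.isTrigCost hA).memLp (hc.isTrigCost hB).memLp
  linarith [hvar A hA, hvar B hB]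

end Circuit

lemma card_ball_le_growth {n : ℕ} (G : SimpleGraph (Fin n)) (v : Fin n) (m : ℕ) :
    (ball G v m).card ≤ growth G m :=
  Finset.le_sup (f := fun v => (ball G v m).card) (Finset.mem_univ v)

namespace Circuit

variable {n : ℕ} {c : Circuit n} {r k : ℕ} {G : SimpleGraph (Fin n)}

/-- Each local term is correlated with at most `k V_G(k + 2 r L)` others. -/
lemma HasTwoPointGenerators.variance_averagedCost_le (hc : c.HasTwoPointGenerators r)
    (hG : c.IsInteractionGraph G r) {O : Fin n → Op n} (hO : IsLocalTerms G k O) :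
    ProbabilityTheory.variance (c.averagedCost O) (uniformAngles c.Idx) ≤
      k * ((growth G (k + 2 * r * c.depth) : ℝ) / n) := by
  classical
  set V := growth G (k + 2 * r * c.depth) with hV
  have hnorm : ∀ v, opNorm (O v) ≤ 1 := fun v => (hO.normalized v).norm_le
  let near (v : Fin n) : Finset (Fin n) := Finset.univ.filter fun w =>
    ∃ p ∈ supp (O v), ∃ q ∈ supp (O w), G.edist p q ≤ (2 * r * c.depth : ℕ)
  have hcard : ∀ v, (near v).card ≤ k * V := fun v => by
    -- Balls are centred at the qubits of `supp (O v)` rather than at `v`: this costs a factor `k`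
    -- but keeps the radius at `k + 2rL` instead of `2k + 2rL`.
    have hsub : near v ⊆ (supp (O v)).biUnion fun p => ball G p (k + 2 * r * c.depth) := by
      intro w hw
      obtain ⟨p, hp, q, hq, hpq⟩ := (Finset.mem_filter.1 hw).2
      refine Finset.mem_biUnion.2 ⟨p, hp, Finset.mem_filter.2 ⟨Finset.mem_univ _, ?_⟩⟩
      have hwq : G.edist w q ≤ k := (Finset.mem_filter.1 (hO.near w hq)).2
      rw [SimpleGraph.edist_comm] at hwq
      refine (SimpleGraph.edist_triangle.trans (add_le_add hpq hwq)).trans ?_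
      rw [add_comm]
      push_cast
      exact le_rfl
    refine (Finset.card_le_card hsub).trans ((Finset.card_biUnion_le_card_mul _ _ V
      fun p _ => card_ball_le_growth G p _).trans ?_)
    exact Nat.mul_le_mul_right V (hO.card_le v)
  have hrow : ∀ v, ∑ w, ProbabilityTheory.covariance (c.cost (O v)) (c.cost (O w))
      (uniformAngles c.Idx) ≤ k * V := fun v => by
    calc ∑ w, ProbabilityTheory.covariance (c.cost (O v)) (c.cost (O w)) (uniformAngles c.Idx)
        = ∑ w ∈ near v, ProbabilityTheory.covariance (c.cost (O v)) (c.cost (O w))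
            (uniformAngles c.Idx) := by
          refine (Finset.sum_subset (Finset.subset_univ _) fun w _ hw => ?_).symm
          refine hc.covariance_cost_eq_zero hG (hnorm v) (hnorm w) fun p hp q hq hpq => hw ?_
          exact Finset.mem_filter.2 ⟨Finset.mem_univ _, p, hp, q, hq, hpq⟩
      _ ≤ ∑ w ∈ near v, (1 : ℝ) :=
          Finset.sum_le_sum fun w _ => hc.covariance_cost_le_one (hnorm v) (hnorm w)
      _ ≤ k * V := by
          rw [Finset.sum_const, nsmul_eq_mul, mul_one]
          exact_mod_cast hcard v
  have hvar : ProbabilityTheory.variance (c.averagedCost O) (uniformAngles c.Idx) =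
      (1 / (n : ℝ)) ^ 2 * ∑ v, ∑ w, ProbabilityTheory.covariance (c.cost (O v)) (c.cost (O w))
        (uniformAngles c.Idx) := by
    rw [← ProbabilityTheory.variance_fun_sum fun v => (hc.isTrigCost (hnorm v)).memLp,
      ← ProbabilityTheory.variance_const_mul]
    rfl
  rw [hvar]
  calc (1 / (n : ℝ)) ^ 2 * ∑ v, ∑ w, ProbabilityTheory.covariance (c.cost (O v)) (c.cost (O w))
        (uniformAngles c.Idx)
      ≤ (1 / (n : ℝ)) ^ 2 * ∑ _v : Fin n, (k * V : ℝ) := by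
        gcongr with v; exact hrow v
    _ = k * ((V : ℝ) / n) := by
        rw [Finset.sum_const, Finset.card_univ, Fintype.card_fin, nsmul_eq_mul]
        rcases Nat.eq_zero_or_pos n with rfl | hn
        · simp
        · field_simp

lemma HasTwoPointGenerators.variance_hessianEntry_averagedCost_le (hc : c.HasTwoPointGenerators r)
    (hG : c.IsInteractionGraph G r) {O : Fin n → Op n} (hO : IsLocalTerms G k O) (a b : c.Idx) :
    ProbabilityTheory.variance (hessianEntry (c.averagedCost O) a b) c.initLaw ≤
      k * ((growth G (k + 2 * r * c.depth) : ℝ) / n) :=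
  ((hc.isTrigCost_averagedCost fun v =>
    (hO.normalized v).norm_le).variance_hessianEntry_le a b).trans (hc.variance_averagedCost_le hG hO)

end Circuit

end PQC

end

theorem theorem3p3 :
    -- (i) global objectives
    (∀ cg α : ℕ → ℕ → ℝ, (∀ r L, 0 < cg r L) → (∀ r L, 0 < α r L) →
      ∃ c' α' : ℕ → ℕ → ℝ, (∀ r L, 0 < c' r L) ∧ (∀ r L, 0 < α' r L) ∧
        ∀ (r : ℕ) (n : ℕ → ℕ) (c : (i : ℕ) → PQC.Circuit (n i)) (O : (i : ℕ) → PQC.Op (n i)),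
          PQC.IsAdmissibleFamily r n c →
          (∀ i, PQC.IsNormalizedObservable (O i)) →
          PQC.IsGlobalFamily n O →
          (∀ i, ProbabilityTheory.variance ((c i).cost (O i)) (c i).initLaw ≤
            cg r (c i).depth * Real.exp (-(α r (c i).depth * (n i : ℝ)))) →
          ∀ (i : ℕ) (a b : (c i).Idx),
            ProbabilityTheory.variance (PQC.hessianEntry ((c i).cost (O i)) a b) (c i).initLaw ≤
              c' r (c i).depth * Real.exp (-(α' r (c i).depth * (n i : ℝ)))) ∧
    -- (ii) local objectives
    (∃ cloc : ℕ → ℕ → ℕ → ℝ, (∀ k r L, 0 < cloc k r L) ∧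
      ∀ (k r : ℕ) (n : ℕ → ℕ) (c : (i : ℕ) → PQC.Circuit (n i))
        (G : (i : ℕ) → SimpleGraph (Fin (n i))) (O : (i : ℕ) → Fin (n i) → PQC.Op (n i)),
          PQC.IsAdmissibleFamily r n c →
          (∀ i, (c i).IsInteractionGraph (G i) r) →
          (∀ i, PQC.IsLocalTerms (G i) k (O i)) →
          ∀ (i : ℕ) (a b : (c i).Idx),
            ProbabilityTheory.variance (PQC.hessianEntry ((c i).averagedCost (O i)) a b)
                (c i).initLaw ≤
              cloc k r (c i).depth *
                ((PQC.growth (G i) (k + 2 * r * (c i).depth) : ℝ) / (n i : ℝ))) ∧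
    -- (ii) local objectives, polynomial growth: `V_G(m) = O(m^D)` uniformly in the family
    (∀ D K : ℝ, 0 < K →
      ∃ cloc : ℕ → ℕ → ℕ → ℝ, (∀ k r L, 0 < cloc k r L) ∧
      ∀ (k r : ℕ) (n : ℕ → ℕ) (c : (i : ℕ) → PQC.Circuit (n i))
        (G : (i : ℕ) → SimpleGraph (Fin (n i))) (O : (i : ℕ) → Fin (n i) → PQC.Op (n i)),
          PQC.IsAdmissibleFamily r n c →
          (∀ i, (c i).IsInteractionGraph (G i) r) →
          (∀ i, PQC.IsLocalTerms (G i) k (O i)) →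
          (∀ (i m : ℕ), 1 ≤ m → (PQC.growth (G i) m : ℝ) ≤ K * (m : ℝ) ^ D) →
          ∀ (i : ℕ) (a b : (c i).Idx),
            ProbabilityTheory.variance (PQC.hessianEntry ((c i).averagedCost (O i)) a b)
                (c i).initLaw ≤
              cloc k r (c i).depth *
                (((k + 2 * r * (c i).depth : ℕ) : ℝ) ^ D / (n i : ℝ))) := by
  -- The constants of (i) are inherited unchanged. In (ii), `k + 1` replaces `k` so that the
  -- constant is positive also for `k = 0`.
  refine ⟨fun cg α hcg hα => ⟨cg, α, hcg, hα, fun r n c O hfam hO _ hvar i a b => ?_⟩,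
    ⟨fun k _ _ => k + 1, fun k _ _ => by positivity, fun k r n c G O hfam hG hO i a b => ?_⟩,
    fun D K hK => ⟨fun k _ _ => (k + 1) * K, fun k _ _ => by positivity,
      fun k r n c G O hfam hG hO hgrowth i a b => ?_⟩⟩
  · exact (((hfam.generators i).isTrigCost (hO i).norm_le).variance_hessianEntry_le a b).trans
      (hvar i)
  · refine ((hfam.generators i).variance_hessianEntry_averagedCost_le (hG i) (hO i) a b).trans ?_
    exact mul_le_mul_of_nonneg_right (by linarith) (by positivity)
  · refine ((hfam.generators i).variance_hessianEntry_averagedCost_le (hG i) (hO i) a b).trans ?_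
    -- The growth hypothesis requires radius at least `1`, which `k ≥ 1` ensures; for `k = 0` the
    -- variance bound is already zero.
    rcases Nat.eq_zero_or_pos k with rfl | hk
    · rw [Nat.cast_zero, zero_mul]
      positivity
    · have h := hgrowth i (k + 2 * r * (c i).depth) (by omega)
      have hpow : (0 : ℝ) ≤ ((k + 2 * r * (c i).depth : ℕ) : ℝ) ^ D := by positivity
      calc (k : ℝ) * ((PQC.growth (G i) (k + 2 * r * (c i).depth) : ℝ) / (n i : ℝ))
          ≤ (k + 1) * (K * ((k + 2 * r * (c i).depth : ℕ) : ℝ) ^ D / (n i : ℝ)) := by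
            gcongr
            linarith
        _ = _ := by ring
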